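/- Let $(R,m)$ be a Noetherian local domain of dimension $d$, with quotient field $K$, and let $e=e(R)$ be its multiplicity, so that $\ell(R/m^n)=P_R(n)=\frac{e}{d!}n^d+(\text{lower order terms})$ for $n\gg 0$, where $P_R$ is the Hilbert–Samuel polynomial of $R$ and $\ell$ denotes length of $R$-modules. Suppose that $R$ contains an infinite field $k$ which maps isomorphically onto $R/m$. Let $\nu$ be a rank $1$ valuation of $K$, with values in $\mathbb R\cup\{\infty\}$ and valuation ring $(V,m_V)$, which dominates $R$ (that is, $R\subset V$ and $m_V\cap R=m$), such that the induced map $R/m\to V/m_V$ is an isomorphism, and normalized so that the smallest element of the value semigroup $S^R(\nu)=\{\nu(f)\mid f\in m\setminus\{0\}\}$ is $1$. For $n\in\mathbb N$ let $\mathcal P_n=\{f\in R\mid \nu(f)\ge n\}$, an ideal of $R$ containing $m^n$. Let $A=\mathrm{gr}_m(R)=\bigoplus_{i\ge 0}m^i/m^{i+1}$, and for $0\ne x\in R$ with $x\in m^i\setminus m^{i+1}$ let $\bar x\in m^i/m^{i+1}\subset A$ be the initial form of $x$. Let $x_1,\dots,x_d\in m\setminus m^2$ be such that $\bar x_1,\dots,\bar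 x_d\in A$ are algebraically independent over $k$ and $\nu(x_i)\ne\nu(x_j)$ for $i\neq j$. Let $B=k[\bar x_1,\dots,\bar x_d]\subset A$, and let $m_1,\dots,m_e\in R$ be nonzero elements whose initial forms $\bar m_1,\dots,\bar m_e$ are linearly independent over $\mathrm{Frac}(B)$, in the sense that the elements $\bar m_i\otimes 1$ of $A\otimes_B\mathrm{Frac}(B)$ are linearly independent over $\mathrm{Frac}(B)$. Then $$ \liminf_{n\to\infty}\frac{\ell(\mathcal P_n/m^n)}{n^d}\;\ge\;\frac{e}{d!}\left(1-\frac{1}{\nu(x_1)\cdots\nu(x_d)}\right). $$ -/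

import Mathlib

open Filter IsLocalRing

open scoped TensorProduct

noncomputable section

/-! ### The associated graded ring and initial forms -/

/-- The associated graded ring `gr_I(R) = ⨁ n, I ^ n / I ^ (n + 1)`, realized as the Rees algebra
`⨁ n, I ^ n t ^ n ⊆ R[t]` modulo the ideal generated by `I`, that is, modulo
`⨁ n, I ^ (n + 1) t ^ n`. -/
def AssociatedGradedRing {R : Type*} [CommRing R] (I : Ideal R) : Type _ :=
  reesAlgebra I ⧸ I.map (algebraMap R (reesAlgebra I))

instance {R : Type*} [CommRing R] (I : Ideal R) : CommRing (AssociatedGradedRing I) :=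
  inferInstanceAs (CommRing (reesAlgebra I ⧸ I.map (algebraMap R (reesAlgebra I))))

instance {k R : Type*} [CommRing k] [CommRing R] [Algebra k R] (I : Ideal R) :
    Algebra k (AssociatedGradedRing I) :=
  inferInstanceAs (Algebra k (reesAlgebra I ⧸ I.map (algebraMap R (reesAlgebra I))))

/-- For `x ∈ I ^ i`, the class of `x` in `I ^ i / I ^ (i + 1)`, as an element of `gr_I(R)`. -/
def gradedClass {R : Type*} [CommRing R] (I : Ideal R) (i : ℕ) (x : R) (hx : x ∈ I ^ i) :
    AssociatedGradedRing I :=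
  Ideal.Quotient.mk (I.map (algebraMap R (reesAlgebra I)))
    ⟨Polynomial.monomial i x, reesAlgebra.monomial_mem.2 hx⟩

/-- The initial degree of a nonzero `x` in a Noetherian local ring with maximal ideal `m`:
the `i` with `x ∈ m ^ i` and `x ∉ m ^ (i + 1)` (and `0` for `x = 0`). -/
def initialDegree {R : Type*} [CommRing R] [IsLocalRing R] (x : R) : ℕ :=
  sSup {i : ℕ | x ∈ maximalIdeal R ^ i}

theorem mem_pow_initialDegree {R : Type*} [CommRing R] [IsLocalRing R] (x : R) :
    x ∈ maximalIdeal R ^ initialDegree x := by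
  by_cases h : BddAbove {i : ℕ | x ∈ maximalIdeal R ^ i}
  · exact Nat.sSup_mem ⟨0, by simp⟩ h
  · rw [initialDegree, Nat.sSup_of_not_bddAbove h]
    simp

/-- The initial form `x̄ ∈ gr_m(R)` of an element `x` of a Noetherian local ring:
the class of `x` in `m ^ i / m ^ (i + 1)`, where `i` is the initial degree of `x`
(and `0` for `x = 0`). -/
def initialForm {R : Type*} [CommRing R] [IsLocalRing R] (x : R) :
    AssociatedGradedRing (maximalIdeal R) :=
  gradedClass (maximalIdeal R) (initialDegree x) x (mem_pow_initialDegree x)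

/-- For a `k`-algebra `A` and `y : ι → A` with `B = k[y_i]`, the images `1 ⊗ z_j` of the elements
`z_j ∈ A` in `Frac(B) ⊗_B A` are linearly independent over `Frac(B)`. -/
def LinearIndependentOverFrac (k : Type*) {A ι κ : Type*} [Field k] [CommRing A] [Algebra k A]
    (y : ι → A) (z : κ → A) : Prop :=
  LinearIndependent (FractionRing (Algebra.adjoin k (Set.range y)))
    fun j => (1 : FractionRing (Algebra.adjoin k (Set.range y)))
      ⊗ₜ[Algebra.adjoin k (Set.range y)] z j

/-! ### The Hilbert-Samuel polynomial -/

/-- `P(n) = ℓ(R / m ^ n)` for all large `n`. -/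
def IsHilbertSamuelPolynomial (R : Type*) [CommRing R] [IsLocalRing R]
    (P : Polynomial ℚ) : Prop :=
  ∀ᶠ n : ℕ in atTop,
    ((Module.length R (R ⧸ maximalIdeal R ^ n)).toNat : ℚ) = P.eval (n : ℚ)

theorem IsHilbertSamuelPolynomial.unique {R : Type*} [CommRing R] [IsLocalRing R]
    {P Q : Polynomial ℚ} (hP : IsHilbertSamuelPolynomial R P)
    (hQ : IsHilbertSamuelPolynomial R Q) : P = Q := by
  obtain ⟨N, hN⟩ := eventually_atTop.1 (hP.and hQ)
  refine Polynomial.eq_of_infinite_eval_eq P Q ?_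
  refine Set.Infinite.mono (s := (fun n : ℕ => (n : ℚ)) '' Set.Ici N) ?_ ?_
  · rintro _ ⟨n, hn, rfl⟩
    exact (hN n hn).1.symm.trans (hN n hn).2
  · exact (Set.Ici_infinite N).image (Nat.cast_injective.injOn)

open Classical in
/-- The Hilbert-Samuel polynomial `P_R` of a Noetherian local ring `R`: the unique polynomial with
`P_R(n) = ℓ(R / m ^ n)` for all large `n`. -/
def hilbertSamuelPolynomial (R : Type*) [CommRing R] [IsLocalRing R] : Polynomial ℚ :=
  if h : ∃ P : Polynomial ℚ, IsHilbertSamuelPolynomial R P then h.choose else 0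

theorem hilbertSamuelPolynomial_eq {R : Type*} [CommRing R] [IsLocalRing R] {P : Polynomial ℚ}
    (hP : IsHilbertSamuelPolynomial R P) : hilbertSamuelPolynomial R = P := by
  have h : ∃ P : Polynomial ℚ, IsHilbertSamuelPolynomial R P := ⟨P, hP⟩
  rw [hilbertSamuelPolynomial, dif_pos h]
  exact h.choose_spec.unique hP

/-! ### Real valuations dominating a local domain

A rank one valuation of a field `K` is written additively, with values in `ℝ ∪ {∞}`. -/

section Valuation

variable {R K : Type*} [CommRing R] [IsLocalRing R] [Field K] [Algebra R K]

/-- `ν` dominates `R`: with `V = {z | 0 ≤ ν z}` and `m_V = {z | 0 < ν z}`, one has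
`R ⊆ V` and `m_V ∩ R = m_R`. -/
structure AddValuation.Dominates (R : Type*) {K : Type*} [CommRing R] [IsLocalRing R] [Field K]
    [Algebra R K] (ν : AddValuation K (WithTop ℝ)) : Prop where
  nonneg : ∀ r : R, 0 ≤ ν (algebraMap R K r)
  pos_iff : ∀ r : R, 0 < ν (algebraMap R K r) ↔ r ∈ maximalIdeal R

/-- The map of residue fields `R / m_R → V / m_V` is onto (for a dominating valuation it is
well-defined and injective, so this says that it is an isomorphism). -/
def AddValuation.ResidueSurjective (R : Type*) {K : Type*} [CommRing R] [Field K]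
    [Algebra R K] (ν : AddValuation K (WithTop ℝ)) : Prop :=
  ∀ z : K, 0 ≤ ν z → ∃ r : R, 0 < ν (z - algebraMap R K r)

/-- The value semigroup `S^R(ν) = ν(m_R \ {0})`. -/
def valueSemigroup (R : Type*) {K : Type*} [CommRing R] [IsLocalRing R] [Field K]
    [Algebra R K] (ν : AddValuation K (WithTop ℝ)) : Set (WithTop ℝ) :=
  {s | ∃ f ∈ maximalIdeal R, f ≠ 0 ∧ ν (algebraMap R K f) = s}

/-- The value of a nonzero element, as a real number. -/
def realValue (ν : AddValuation K (WithTop ℝ)) (z : K) : ℝ :=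
  (ν z).untopD 0

/-- The ideal `𝒫_c = {f ∈ R | c ≤ ν f}` of `R`. -/
def valuationIdeal {ν : AddValuation K (WithTop ℝ)} (h : ν.Dominates R) (c : ℝ) : Ideal R where
  carrier := {f | (c : WithTop ℝ) ≤ ν (algebraMap R K f)}
  zero_mem' := by simp
  add_mem' := by
    intro a b ha hb
    simp only [Set.mem_ofPred_eq, map_add] at *
    exact ν.map_le_add ha hb
  smul_mem' := by
    intro a b hb
    simp only [Set.mem_ofPred_eq, smul_eq_mul, map_mul, ν.map_mul] at *
    exact hb.trans (le_add_of_nonneg_left (h.nonneg a))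

/-- The length `ℓ(𝒫_n / m ^ n)` of the `R`-module `𝒫_n / m ^ n`. -/
def lengthQuotient {ν : AddValuation K (WithTop ℝ)} (h : ν.Dominates R) (n : ℕ) : ℕ∞ :=
  Module.length R
    (valuationIdeal h (n : ℝ) ⧸ (maximalIdeal R ^ n).submoduleOf (valuationIdeal h (n : ℝ)))

end Valuation

end

/-! The initial forms of the products `x^a * m_j` are linearly independent over `k` in the
associated graded ring, so the products of initial degree less than `n` stay independent modulo the
`n`-th power of the maximal ideal. Since `x_i` has degree 1, the degree is at most `|a| + C`, with
`C` bounding the degrees of the `m_j`; since `m_j` has nonnegative value, the product lies in `𝒫_n`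
once `∑ a_i ν(x_i) ≥ n`. As `k` is the residue field, length is dimension over `k`, and `ℓ(𝒫_n/m^n)`
is at least `e` times the number of `a` with `|a| + C < n` and `∑ a_i ν(x_i) ≥ n`
(`card_monomials_le_lengthQuotient`). Comparing two simplices (`le_simplexCount`, `simplexCount_le`)
bounds that number below by `(n - C)^d / d! - (n + σ)^d / (d! ∏ ν(x_i))`, where `σ = ∑ ν(x_i)`.
Dividing by `n^d` gives the limit. -/

section GradedClass

/-! ### Arithmetic of classes in the associated graded ring. -/

variable {R : Type*} [CommRing R] {I : Ideal R}

theorem gradedClass_mul {i j : ℕ} {x y : R} (hx : x ∈ I ^ i) (hy : y ∈ I ^ j) :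
    ∃ h, gradedClass I i x hx * gradedClass I j y hy = gradedClass I (i + j) (x * y) h := by
  refine ⟨pow_add I i j ▸ Ideal.mul_mem_mul hx hy, ?_⟩
  refine (map_mul (Ideal.Quotient.mk (I.map (algebraMap R (reesAlgebra I)))) _ _).symm.trans ?_
  refine congrArg (Ideal.Quotient.mk (I.map (algebraMap R (reesAlgebra I)))) (Subtype.ext ?_)
  exact Polynomial.monomial_mul_monomial i j x y

theorem gradedClass_pow {i : ℕ} {x : R} (hx : x ∈ I ^ i) (n : ℕ) :
    ∃ h, gradedClass I i x hx ^ n = gradedClass I (n * i) (x ^ n) h := by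
  refine ⟨by rw [mul_comm, pow_mul]; exact Ideal.pow_mem_pow hx n, ?_⟩
  refine (map_pow (Ideal.Quotient.mk (I.map (algebraMap R (reesAlgebra I)))) _ _).symm.trans ?_
  refine congrArg (Ideal.Quotient.mk (I.map (algebraMap R (reesAlgebra I)))) (Subtype.ext ?_)
  exact (Polynomial.monomial_pow i x n).trans (congrArg (Polynomial.monomial · (x ^ n)) (mul_comm i n))

theorem gradedClass_one : ∃ h, (1 : AssociatedGradedRing I) = gradedClass I 0 1 h :=
  ⟨by simp, rfl⟩

theorem gradedClass_prod {ι : Type*} (s : Finset ι) (i : ι → ℕ) (x : ι → R)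
    (hx : ∀ a, x a ∈ I ^ i a) :
    ∃ h, ∏ a ∈ s, gradedClass I (i a) (x a) (hx a) =
      gradedClass I (∑ a ∈ s, i a) (∏ a ∈ s, x a) h := by
  classical
  induction s using Finset.induction_on with
  | empty => exact gradedClass_one
  | insert a s ha ih =>
    obtain ⟨h, e⟩ := ih
    simp only [Finset.prod_insert ha, Finset.sum_insert ha, e]
    exact gradedClass_mul _ _

theorem gradedClass_eq_zero {i : ℕ} {x : R} (hx : x ∈ I ^ i) (h : x ∈ I ^ (i + 1)) :
    gradedClass I i x hx = 0 := by
  refine Ideal.Quotient.eq_zero_iff_mem.2 ?_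
  rw [pow_succ'] at h
  -- For `a ∈ I` and `b ∈ I ^ i`, the monomial of `a * b` is `a` times an element of the Rees
  -- algebra.
  refine Submodule.mul_induction_on' (C := fun x hx => ∀ h : x ∈ I ^ i,
    (⟨Polynomial.monomial i x, reesAlgebra.monomial_mem.2 h⟩ : reesAlgebra I) ∈
      I.map (algebraMap R (reesAlgebra I))) ?_ ?_ h hx
  · intro a ha b hb _
    have := Ideal.mul_mem_right (⟨Polynomial.monomial i b, reesAlgebra.monomial_mem.2 hb⟩ :
      reesAlgebra I) _ (Ideal.mem_map_of_mem (algebraMap R (reesAlgebra I)) ha)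
    convert this using 1
    refine Subtype.ext ?_
    exact (Polynomial.C_mul_monomial ..).symm
  · intro a ha b hb iha ihb _
    have hle : I * I ^ i ≤ I ^ i := Ideal.mul_le_right
    convert add_mem (iha (hle ha)) (ihb (hle hb)) using 1
    refine Subtype.ext ?_
    exact (Polynomial.monomial i).map_add a b

theorem gradedClass_add {i : ℕ} {x y : R} (hx : x ∈ I ^ i) (hy : y ∈ I ^ i) :
    gradedClass I i x hx + gradedClass I i y hy = gradedClass I i (x + y) (add_mem hx hy) := by
  refine (map_add (Ideal.Quotient.mk (I.map (algebraMap R (reesAlgebra I)))) _ _).symm.trans ?_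
  refine congrArg (Ideal.Quotient.mk (I.map (algebraMap R (reesAlgebra I)))) (Subtype.ext ?_)
  exact ((Polynomial.monomial i).map_add x y).symm

variable {k : Type*} [CommRing k] [Algebra k R]

theorem smul_gradedClass {i : ℕ} {x : R} (c : k) (hx : x ∈ I ^ i) :
    c • gradedClass I i x hx = gradedClass I i (c • x) (Submodule.smul_of_tower_mem _ c hx) := by
  refine congrArg (Ideal.Quotient.mk (I.map (algebraMap R (reesAlgebra I)))) (Subtype.ext ?_)
  exact Polynomial.smul_monomial c i x

theorem gradedClass_sum_smul {ι : Type*} (s : Finset ι) (N : ℕ) (D : ι → ℕ) (g : ι → R)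
    (hg : ∀ i, g i ∈ I ^ D i) (hs : ∀ i ∈ s, D i = N) (c : ι → k) :
    ∃ h, ∑ i ∈ s, c i • gradedClass I (D i) (g i) (hg i) =
      gradedClass I N (∑ i ∈ s, c i • g i) h := by
  classical
  induction s using Finset.induction_on with
  | empty => exact ⟨by simp, by simpa using (gradedClass_eq_zero (by simp) (by simp)).symm⟩
  | insert a s ha ih =>
    obtain ⟨h, e⟩ := ih fun i hi => hs i (Finset.mem_insert_of_mem hi)
    obtain rfl := hs a (Finset.mem_insert_self a s)
    have hs' : c a • g a + ∑ i ∈ s, c i • g i = ∑ i ∈ insert a s, c i • g i := by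
      rw [Finset.sum_insert ha]
    refine ⟨hs' ▸ add_mem (Submodule.smul_of_tower_mem _ _ (hg a)) h, ?_⟩
    rw [Finset.sum_insert ha, e, smul_gradedClass, gradedClass_add]
    congr 1

/-- If the classes of the `g i` in `gr_I(R)` are linearly independent, then the `g i` of degree
less than `n` are linearly independent modulo `I ^ n`. -/
theorem eq_zero_of_sum_smul_mem_pow {ι : Type*} [Fintype ι] {n : ℕ} {D : ι → ℕ} {g : ι → R}
    {hg : ∀ i, g i ∈ I ^ D i}
    (hli : LinearIndependent k fun i => gradedClass I (D i) (g i) (hg i))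
    (hD : ∀ i, D i < n) {c : ι → k} (hc : ∑ i, c i • g i ∈ I ^ n) (i : ι) : c i = 0 := by
  classical
  suffices ∀ N, ∀ i, D i = N → c i = 0 from this _ i rfl
  -- Induction on degree: terms of degree below `N` vanish already and those above lie in `I ^ (N +
  -- 1)`, so the degree `N` part gives a relation in the graded ring.
  intro N
  induction N using Nat.strong_induction_on with
  | _ N ih =>
    intro i hi
    have hn : N < n := hi ▸ hD i
    obtain ⟨h, e⟩ := gradedClass_sum_smul (Finset.univ.filter fun i => D i = N) N D g hg
      (fun i hi => (Finset.mem_filter.1 hi).2) c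
    have hmem : ∑ i ∈ Finset.univ.filter (fun i => D i = N), c i • g i ∈ I ^ (N + 1) := by
      rw [← Finset.sum_filter_add_sum_filter_not Finset.univ fun i => D i = N] at hc
      refine (Submodule.add_mem_iff_left _ (Submodule.sum_mem _ fun j hj => ?_)).1
        (Ideal.pow_le_pow_right hn hc)
      have hj' : D j ≠ N := (Finset.mem_filter.1 hj).2
      rcases lt_or_gt_of_ne hj' with h | h
      · simp [ih _ h j rfl]
      · exact Submodule.smul_of_tower_mem _ _ (Ideal.pow_le_pow_right h (hg j))
    rw [gradedClass_eq_zero h hmem] at e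
    exact linearIndependent_iff'.1 hli _ c e i (by simp [hi])

end GradedClass

/-! ### Independence over `k`, and length as dimension. -/

theorem initialDegree_eq_one {R : Type*} [CommRing R] [IsLocalRing R] {x : R}
    (h1 : x ∈ maximalIdeal R) (h2 : x ∉ maximalIdeal R ^ 2) : initialDegree x = 1 := by
  refine IsGreatest.csSup_eq ⟨by simpa using h1, fun i hi => ?_⟩
  by_contra! h
  exact h2 (Ideal.pow_le_pow_right h hi)

/-- Tower argument: the monomials in `y` are independent over `k` in `B = k[y]`, and `z` is
independent over `B` because `B` embeds in its fraction field. -/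
theorem LinearIndependentOverFrac.linearIndependent_mul {k A ι κ : Type*} [Field k] [CommRing A]
    [Algebra k A] {y : ι → A} {z : κ → A} (hy : AlgebraicIndependent k y)
    (hz : LinearIndependentOverFrac k y z) :
    LinearIndependent k fun p : (ι →₀ ℕ) × κ =>
      (p.1.prod fun i n => y i ^ n) * z p.2 := by
  let B := Algebra.adjoin k (Set.range y)
  let b : (ι →₀ ℕ) → B := fun a =>
    ⟨a.prod fun i n => y i ^ n, Submonoid.prod_mem B.toSubmonoid fun i _ =>
      B.pow_mem (Algebra.subset_adjoin ⟨i, rfl⟩) _⟩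
  have hb : LinearIndependent k b := by
    refine LinearIndependent.of_comp B.val.toLinearMap ?_
    have h1 := (MvPolynomial.basisMonomials ι k).linearIndependent.map'
      (MvPolynomial.aeval (R := k) y).toLinearMap (LinearMap.ker_eq_bot.2 hy)
    have h2 : (MvPolynomial.aeval (R := k) y).toLinearMap ∘ MvPolynomial.basisMonomials ι k =
        B.val.toLinearMap ∘ b := by
      ext a
      simp [b, MvPolynomial.aeval_monomial]
    rwa [h2] at h1
  have hz' : LinearIndependent B z := by
    refine LinearIndependent.of_comp (TensorProduct.mk B (FractionRing B) A 1) ?_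
    refine LinearIndependent.restrict_scalars (K := FractionRing B) ?_ hz
    intro u v huv
    refine IsFractionRing.injective B (FractionRing B) ?_
    simpa [Algebra.smul_def] using huv
  exact linearIndependent_smul hb hz'

theorem card_le_toNat_length {k R M ι : Type*} [Field k] [CommRing R] [IsLocalRing R] [Algebra k R]
    (hk : Function.Bijective (algebraMap k (ResidueField R))) [AddCommGroup M] [Module k M]
    [Module R M] [IsScalarTower k R M] (hM : Module.length R M ≠ ⊤) [Fintype ι] {v : ι → M}
    (hv : LinearIndependent k v) : Fintype.card ι ≤ (Module.length R M).toNat := by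
  -- The residue extension has degree 1, so lengths over `R` and over `k` agree.
  have h1 : Module.length (ResidueField k) (ResidueField R) = 1 := by
    rw [← Module.length_eq_of_surjective (S := k) (residue_surjective (R := k)),
      ← (LinearEquiv.ofBijective (Algebra.linearMap k (ResidueField R)) hk).length_eq]
    exact Module.length_eq_one k k
  have h2 := IsLocalRing.length_restrictScalars k R M
  rw [h1, mul_one, Module.length_eq_rank] at h2
  rw [← h2] at hM ⊢
  have h3 : (Fintype.card ι : ℕ∞) ≤ (Module.rank k M).toENat := by
    have := Cardinal.toENat.monotone' hv.cardinal_lift_le_rank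
    simpa using this
  rw [← ENat.natCast_toNat hM] at h3
  exact_mod_cast h3

theorem length_quotient_maximalIdeal_pow_ne_top {R : Type*} [CommRing R] [IsLocalRing R]
    [IsNoetherianRing R] (n : ℕ) : Module.length R (R ⧸ maximalIdeal R ^ n) ≠ ⊤ := by
  rcases Nat.eq_zero_or_pos n with rfl | hn
  · have : Subsingleton (R ⧸ maximalIdeal R ^ 0) := by
      rw [pow_zero, Ideal.one_eq_top]; infer_instance
    simp
  · have : IsArtinianRing (R ⧸ maximalIdeal R ^ n) := by
      refine IsLocalRing.quotient_artinian_of_mem_minimalPrimes_of_isLocalRing _ ?_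
      refine ⟨⟨inferInstance, Ideal.pow_le_self hn.ne'⟩, fun q hq _ => ?_⟩
      exact hq.1.le_of_pow_le hq.2
    rw [Module.length_eq_of_surjective (R := R ⧸ maximalIdeal R ^ n)
      Ideal.Quotient.mk_surjective]
    exact Module.length_ne_top

/-! ### Finiteness of lengths and values of monomials. -/

section Valuation

variable {R K : Type*} [CommRing R] [IsLocalRing R] [IsNoetherianRing R] [Field K] [Algebra R K]

/-- The quotient embeds in `R / m ^ n`. Finiteness matters because `toNat` sends `⊤` to `0`. -/
theorem lengthQuotient_ne_top {ν : AddValuation K (WithTop ℝ)} (h : ν.Dominates R) (n : ℕ) :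
    lengthQuotient h n ≠ ⊤ := by
  refine ne_top_of_le_ne_top (length_quotient_maximalIdeal_pow_ne_top (R := R) n)
    (Module.length_le_of_injective (Submodule.mapQ _ _ (valuationIdeal h n).subtype le_rfl) ?_)
  refine LinearMap.ker_eq_bot.1 (Submodule.ker_liftQ_eq_bot _ _ _ ?_)
  rw [LinearMap.ker_comp, Submodule.ker_mkQ]; rfl

theorem addValuation_prod_pow (ν : AddValuation K (WithTop ℝ)) {ι : Type*} (s : Finset ι)
    (x : ι → K) (hx : ∀ i, ν (x i) ≠ ⊤) (a : ι → ℕ) :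
    ν (∏ i ∈ s, x i ^ a i) = ((∑ i ∈ s, (a i : ℝ) * realValue ν (x i) : ℝ) : WithTop ℝ) := by
  classical
  induction s using Finset.induction_on with
  | empty => simp
  | insert i s hi ih =>
    obtain ⟨r, hr⟩ := WithTop.ne_top_iff_exists.1 (hx i)
    rw [Finset.prod_insert hi, Finset.sum_insert hi, ν.map_mul, ih, ν.map_pow, realValue, ← hr,
      WithTop.untopD_coe, ← WithTop.coe_nsmul, WithTop.coe_add, nsmul_eq_mul]

end Valuation
-- Counting lattice points in simplices.
theorem pow_succ_sub_ge (d : ℕ) (s v : ℝ) (hs : 0 ≤ s) (hv : 0 ≤ v) :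
    (d + 1) * v * s ^ d ≤ (s + v) ^ (d + 1) - s ^ (d + 1) := by
  induction d with
  | zero => simp
  | succ d ih =>
    have h : (s + v) ^ (d + 1 + 1) - s ^ (d + 1 + 1) =
      s * ((s + v) ^ (d + 1) - s ^ (d + 1)) + v * (s + v) ^ (d + 1) := by ring
    have h2 : s ^ (d + 1) ≤ (s + v) ^ (d + 1) := by gcongr; linarith
    have h3 := mul_le_mul_of_nonneg_left ih hs
    have h4 := mul_le_mul_of_nonneg_left h2 hv
    rw [h]
    push_cast
    calc _ = s * ((d + 1) * v * s ^ d) + v * s ^ (d + 1) := by ring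
      _ ≤ _ := by linarith

theorem pow_succ_sub_le (d : ℕ) (s v : ℝ) (hs : 0 ≤ s) (hv : 0 ≤ v) :
    (s + v) ^ (d + 1) - s ^ (d + 1) ≤ (d + 1) * v * (s + v) ^ d := by
  induction d with
  | zero => simp
  | succ d ih =>
    have h : (s + v) ^ (d + 1 + 1) - s ^ (d + 1 + 1) =
      (s + v) * ((s + v) ^ (d + 1) - s ^ (d + 1)) + v * s ^ (d + 1) := by ring
    have h2 : s ^ (d + 1) ≤ (s + v) ^ (d + 1) := by gcongr; linarith
    have h3 := mul_le_mul_of_nonneg_left ih (add_nonneg hs hv)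
    have h4 := mul_le_mul_of_nonneg_left h2 hv
    rw [h]
    push_cast
    calc _ ≤ (s + v) * ((d + 1) * v * (s + v) ^ d) + v * (s + v) ^ (d + 1) := by linarith
      _ = _ := by ring

open Classical in
/-- The number of lattice points of the box `[0, N)ᵈ` in the open simplex `∑ aᵢ wᵢ < t`. -/
noncomputable def simplexCount (d N : ℕ) (w : Fin d → ℝ) (t : ℝ) : ℝ :=
  ∑ a : Fin d → Fin N, if ∑ i, ((a i : ℕ) : ℝ) * w i < t then 1 else 0

theorem simplexCount_succ (d N : ℕ) (w : Fin (d + 1) → ℝ) (t : ℝ) :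
    simplexCount (d + 1) N w t =
      ∑ j ∈ Finset.range N, simplexCount d N (fun i => w i.succ) (t - j * w 0) := by
  classical
  simp only [simplexCount]
  rw [← Equiv.sum_comp (Fin.consEquiv fun _ => Fin N), Fintype.sum_prod_type, Finset.sum_range]
  refine Finset.sum_congr rfl fun j _ => Finset.sum_congr rfl fun a _ => ?_
  simp [Fin.sum_univ_succ, lt_sub_iff_add_lt']

theorem simplexCount_eq_zero {d N : ℕ} {w : Fin d → ℝ} (hw : ∀ i, 0 ≤ w i) {t : ℝ} (ht : t ≤ 0) :
    simplexCount d N w t = 0 := by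
  refine Finset.sum_eq_zero fun a _ => if_neg (not_lt.2 (ht.trans ?_))
  exact Finset.sum_nonneg fun i _ => mul_nonneg (Nat.cast_nonneg _) (hw i)

/-- Unit cubes based at the points lie in the simplex of size `t + ∑ w i`, whose volume is the
bound. The proof slices by the first coordinate and telescopes. -/
theorem simplexCount_le {d N : ℕ} {w : Fin d → ℝ} (hw : ∀ i, 0 < w i) {t : ℝ} (ht : 0 ≤ t) :
    simplexCount d N w t ≤ (t + ∑ i, w i) ^ d / (d.factorial * ∏ i, w i) := by
  classical
  induction d generalizing t with
  | zero => simp only [simplexCount]; simp; split_ifs <;> norm_num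
  | succ d ih =>
    rw [simplexCount_succ, Fin.sum_univ_succ, Fin.prod_univ_succ]
    set σ := ∑ i : Fin d, w i.succ with hσ
    set π := ∏ i : Fin d, w i.succ with hπ
    have hσ0 : 0 ≤ σ := Finset.sum_nonneg fun i _ => (hw _).le
    have hπ0 : 0 < π := Finset.prod_pos fun i _ => hw _
    have h0 := hw 0
    -- Clamping at `0` keeps `G` decreasing, so empty slices cost nothing.
    let G : ℕ → ℝ := fun j => max (t - j * w 0 + σ + w 0) 0 ^ (d + 1)
    have hG : ∀ j, 0 ≤ G j := fun j => by positivity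
    have hD : (0 : ℝ) < (d + 1).factorial * (w 0 * π) := by positivity
    have key : ∀ j ∈ Finset.range N, simplexCount d N (fun i => w i.succ) (t - j * w 0) ≤
        (G j - G (j + 1)) / ((d + 1).factorial * (w 0 * π)) := by
      intro j _
      rcases le_or_gt (t - j * w 0) 0 with h | h
      · rw [simplexCount_eq_zero (fun i => (hw _).le) h]
        refine div_nonneg (sub_nonneg.2 ?_) hD.le
        refine pow_le_pow_left₀ (le_max_right _ _) (max_le_max ?_ le_rfl) _
        push_cast; linarith
      · refine (ih (fun i => hw _) h.le).trans ?_
        have e1 : G j = (t - j * w 0 + σ + w 0) ^ (d + 1) := by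
          simp only [G]; rw [max_eq_left (by linarith)]
        have e2 : G (j + 1) = (t - j * w 0 + σ) ^ (d + 1) := by
          simp only [G]; push_cast
          rw [max_eq_left (by linarith)]; congr 1; ring
        have := pow_succ_sub_ge d (t - j * w 0 + σ) (w 0) (by linarith) h0.le
        rw [e1, e2, div_le_div_iff₀ (by positivity) hD, Nat.factorial_succ]
        push_cast
        have h5 := mul_le_mul_of_nonneg_right this (show 0 ≤ (d.factorial : ℝ) * π by positivity)
        calc _ = (d + 1) * w 0 * (t - j * w 0 + σ) ^ d * (d.factorial * π) := by ring
          _ ≤ _ := h5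
    refine (Finset.sum_le_sum key).trans ?_
    rw [← Finset.sum_div, Finset.sum_range_sub']
    gcongr
    have : G 0 = (t + (w 0 + σ)) ^ (d + 1) := by
      simp only [G]; push_cast
      rw [max_eq_left (by linarith)]; congr 1; ring
    linarith [hG N]

/-- The case `n = 0` is set apart because for `d = 0` the left side is `1` while the strict simplex
is empty. -/
theorem le_simplexCount {d N n : ℕ} (hn : n ≤ N) :
    (n : ℝ) ^ d / d.factorial ≤ simplexCount d N 1 n ∨ n = 0 := by
  classical
  induction d generalizing n with
  | zero =>
    rcases Nat.eq_zero_or_pos n with h | h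
    · exact Or.inr h
    · left; simp only [simplexCount]; simp [h]
  | succ d ih =>
    left
    rw [simplexCount_succ]
    let G : ℕ → ℝ := fun j => ((n - j : ℕ) : ℝ) ^ (d + 1)
    have key : ∀ j ∈ Finset.range N, (G j - G (j + 1)) / (d + 1).factorial ≤
        simplexCount d N (fun i => (1 : Fin (d + 1) → ℝ) i.succ)
          (n - j * (1 : Fin (d + 1) → ℝ) 0) := by
      intro j _
      have e : (fun i : Fin d => (1 : Fin (d + 1) → ℝ) i.succ) = 1 := rfl
      rw [e, Pi.one_apply, mul_one]
      rcases le_or_gt n j with h | h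
      · rw [simplexCount_eq_zero (by simp) (by simpa using h)]
        simp [G, Nat.sub_eq_zero_of_le h, Nat.sub_eq_zero_of_le (h.trans (Nat.le_succ j))]
      · have h1 := (ih (n := n - j) ((Nat.sub_le _ _).trans hn)).resolve_right (by omega)
        rw [Nat.cast_sub h.le] at h1
        refine le_trans ?_ h1
        have := pow_succ_sub_le d ((n - (j + 1) : ℕ) : ℝ) 1 (by positivity) zero_le_one
        have e3 : ((n - (j + 1) : ℕ) : ℝ) + 1 = n - j := by
          rw [Nat.cast_sub h]; push_cast; ring
        rw [e3] at this
        simp only [G]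
        rw [Nat.cast_sub h.le, Nat.factorial_succ, div_le_div_iff₀ (by positivity) (by positivity)]
        push_cast
        have h5 := mul_le_mul_of_nonneg_right this (show 0 ≤ (d.factorial : ℝ) by positivity)
        calc _ ≤ _ := h5
          _ = _ := by ring
    refine le_trans ?_ (Finset.sum_le_sum key)
    rw [← Finset.sum_div, Finset.sum_range_sub']
    simp [G, Nat.sub_eq_zero_of_le hn]

/-! ### From lattice points to length, and the limit. -/

theorem card_monomials_le_lengthQuotient {k R K : Type*} [Field k] [CommRing R] [IsLocalRing R]
    [IsNoetherianRing R] [Field K] [Algebra R K] [Algebra k R]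
    (hk : Function.Bijective (algebraMap k (ResidueField R)))
    {ν : AddValuation K (WithTop ℝ)} (hν : ν.Dominates R) {d e : ℕ}
    {x : Fin d → R} (hx : ∀ i, x i ∈ maximalIdeal R ∧ x i ∉ maximalIdeal R ^ 2)
    (hxν : ∀ i, ν (algebraMap R K (x i)) ≠ ⊤)
    (hxalg : AlgebraicIndependent k fun i => initialForm (x i)) {m : Fin e → R}
    (hm : LinearIndependentOverFrac k (fun i => initialForm (x i)) fun i => initialForm (m i))
    {n C : ℕ} (hC : ∀ j, initialDegree (m j) ≤ C) (s : Finset (Fin d → Fin n))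
    (hs : ∀ a ∈ s, ∑ i, (a i : ℕ) + C < n)
    (hs' : ∀ a ∈ s, (n : ℝ) ≤ ∑ i, ((a i : ℕ) : ℝ) * realValue ν (algebraMap R K (x i))) :
    s.card * e ≤ (lengthQuotient hν n).toNat := by
  classical
  let D : s × Fin e → ℕ := fun p =>
    ∑ i, (p.1.1 i : ℕ) * initialDegree (x i) + initialDegree (m p.2)
  let g : s × Fin e → R := fun p => (∏ i, x i ^ (p.1.1 i : ℕ)) * m p.2
  have key : ∀ p : s × Fin e, ∃ h, (∏ i, initialForm (x i) ^ (p.1.1 i : ℕ)) * initialForm (m p.2) =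
      gradedClass (maximalIdeal R) (D p) (g p) h := by
    intro p
    have h1 : ∀ i, ∃ h, initialForm (x i) ^ (p.1.1 i : ℕ) =
        gradedClass (maximalIdeal R) ((p.1.1 i : ℕ) * initialDegree (x i)) (x i ^ (p.1.1 i : ℕ)) h :=
      fun i => gradedClass_pow _ _
    choose h2 h3 using h1
    obtain ⟨h4, h5⟩ := gradedClass_prod Finset.univ _ _ h2
    rw [Finset.prod_congr rfl fun i _ => h3 i, h5]
    exact gradedClass_mul _ _
  choose hg hgc using key
  have hli : LinearIndependent k fun p => gradedClass (maximalIdeal R) (D p) (g p) (hg p) := by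
    simp only [← hgc]
    let φ : s × Fin e → (Fin d →₀ ℕ) × Fin e := fun p =>
      (Finsupp.equivFunOnFinite.symm fun i => (p.1.1 i : ℕ), p.2)
    have hφ : Function.Injective φ := by
      intro p q h
      have h1 := Finsupp.equivFunOnFinite.symm.injective (Prod.ext_iff.1 h).1
      have h2 : p.2 = q.2 := (Prod.ext_iff.1 h).2
      exact Prod.ext (Subtype.ext (funext fun i => Fin.ext (congrFun h1 i))) h2
    have := (hm.linearIndependent_mul hxalg).comp φ hφ
    convert this using 1
    funext p
    simp [φ, Finsupp.prod_fintype]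
  have hD : ∀ p, D p < n := by
    intro p
    have h1 : D p = ∑ i, (p.1.1 i : ℕ) + initialDegree (m p.2) := by
      simp [D, fun i => initialDegree_eq_one (hx i).1 (hx i).2]
    have := hs _ p.1.2
    have := hC p.2
    omega
  have hgP : ∀ p, g p ∈ valuationIdeal hν n := by
    intro p
    change ((n : ℝ) : WithTop ℝ) ≤ ν (algebraMap R K (g p))
    simp only [g, map_mul, map_prod, map_pow]
    rw [ν.map_mul, addValuation_prod_pow ν _ _ hxν]
    exact (WithTop.coe_le_coe.2 (hs' _ p.1.2)).trans (le_add_of_nonneg_right (hν.nonneg _))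
  let P := valuationIdeal hν (n : ℝ)
  let Q : Submodule R P := (maximalIdeal R ^ n).submoduleOf P
  have hv : LinearIndependent k fun p => Q.mkQ ⟨g p, hgP p⟩ := by
    rw [Fintype.linearIndependent_iff]
    intro c hc
    refine eq_zero_of_sum_smul_mem_pow hli hD ?_
    have h1 : Q.mkQ (∑ p, c p • ⟨g p, hgP p⟩) = 0 := by
      rw [← hc, map_sum]; rfl
    rw [Submodule.mkQ_apply, Submodule.Quotient.mk_eq_zero] at h1
    simpa [Q, Submodule.submoduleOf] using h1
  have := card_le_toNat_length hk (lengthQuotient_ne_top hν n) hv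
  simpa [lengthQuotient] using this

theorem tendsto_natCast_add_pow_div (d : ℕ) (c : ℝ) :
    Tendsto (fun n : ℕ => ((n : ℝ) + c) ^ d / (n : ℝ) ^ d) atTop (nhds 1) := by
  have h1 : Tendsto (fun n : ℕ => (1 + c / (n : ℝ)) ^ d) atTop (nhds ((1 + 0) ^ d)) :=
    (tendsto_const_nhds.add (tendsto_const_div_atTop_nhds_zero_nat c)).pow d
  rw [add_zero, one_pow] at h1
  refine h1.congr' ?_
  filter_upwards [eventually_ne_atTop 0] with n hn
  have : (n : ℝ) ≠ 0 := Nat.cast_ne_zero.2 hn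
  rw [← div_pow, add_div, div_self this]

open Classical in
-- A set difference has at least the difference of the cardinalities; neither simplex need contain
-- the other.
theorem simplexCount_sub_le_card {d n C : ℕ} (hn : C ≤ n) (w : Fin d → ℝ) :
    simplexCount d n 1 ((n - C : ℕ) : ℝ) - simplexCount d n w n ≤
      (Finset.univ.filter fun a : Fin d → Fin n =>
        ∑ i, (a i : ℕ) + C < n ∧ (n : ℝ) ≤ ∑ i, ((a i : ℕ) : ℝ) * w i).card := by
  rw [Finset.card_filter, Nat.cast_sum, sub_le_iff_le_add]
  simp only [simplexCount, ← Finset.sum_add_distrib]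
  refine Finset.sum_le_sum fun a _ => ?_
  have h1 : ∑ i, ((a i : ℕ) : ℝ) * (1 : Fin d → ℝ) i < ((n - C : ℕ) : ℝ) ↔
      ∑ i, (a i : ℕ) + C < n := by
    simp only [Pi.one_apply, mul_one]
    rw [← Nat.cast_sum, Nat.cast_lt]; omega
  rw [if_congr h1 rfl rfl]
  by_cases h2 : ∑ i, ((a i : ℕ) : ℝ) * w i < n
  · simp only [h2, not_le.2 h2]; split_ifs <;> simp
  · simp only [h2, not_lt.1 h2]; split_ifs <;> simp_all

theorem mainTheorem4
    {k R K : Type*} [Field k] [Infinite k]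
    [CommRing R] [IsDomain R] [IsLocalRing R] [IsNoetherianRing R]
    [Field K] [Algebra R K] [IsFractionRing R K] [Algebra k R]
    -- `k` is a field of representatives of `R`
    (hk : Function.Bijective (algebraMap k (ResidueField R)))
    -- dimension and multiplicity of `R`
    (d e : ℕ) (hd : ringKrullDim R = d)
    (he : (e : ℚ) = (d.factorial : ℚ) * (hilbertSamuelPolynomial R).coeff d)
    -- the valuation
    (ν : AddValuation K (WithTop ℝ)) (hν : ν.Dominates R) (hres : ν.ResidueSurjective R)
    (hmin : IsLeast (valueSemigroup R ν) 1)
    -- the elements `x_1, …, x_d`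
    (x : Fin d → R) (hx : ∀ i, x i ∈ maximalIdeal R ∧ x i ∉ maximalIdeal R ^ 2)
    (hxalg : AlgebraicIndependent k fun i => initialForm (x i))
    (hxval : ∀ i j, i ≠ j → ν (algebraMap R K (x i)) ≠ ν (algebraMap R K (x j)))
    -- the elements `m_1, …, m_e`
    (m : Fin e → R)
    (hm : LinearIndependentOverFrac k (fun i => initialForm (x i)) fun i => initialForm (m i)) :
    (((e : ℝ) / d.factorial * (1 - 1 / ∏ i, realValue ν (algebraMap R K (x i))) : ℝ) : EReal) ≤
      liminf (fun n : ℕ => ((((lengthQuotient hν n).toNat : ℝ) / (n : ℝ) ^ d : ℝ) : EReal))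
        atTop := by
  classical
  have hx0 : ∀ i, x i ≠ 0 := fun i h => (hx i).2 (h ▸ zero_mem _)
  have hxν : ∀ i, ν (algebraMap R K (x i)) ≠ ⊤ := fun i h =>
    hx0 i (IsFractionRing.injective R K (by rw [map_zero]; exact ν.top_iff.1 h))
  let w : Fin d → ℝ := fun i => realValue ν (algebraMap R K (x i))
  have hw : ∀ i, 0 < w i := by
    intro i
    have h1 := (hν.pos_iff (x i)).2 (hx i).1
    obtain ⟨r, hr⟩ := WithTop.ne_top_iff_exists.1 (hxν i)
    simp only [w, realValue]
    rw [← hr] at h1 ⊢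
    simpa using h1
  obtain ⟨C, hC⟩ : ∃ C, ∀ j, initialDegree (m j) ≤ C :=
    ⟨_, fun j => Finset.le_sup (f := fun j => initialDegree (m j)) (Finset.mem_univ j)⟩
  let σ := ∑ i, w i
  -- Explicit lower bound for the length divided by `n ^ d`; the shifts `-C` and `σ` disappear in
  -- the limit.
  let v : ℕ → ℝ := fun n => e / d.factorial * (((n : ℝ) + (-C : ℝ)) ^ d / (n : ℝ) ^ d -
    ((n : ℝ) + σ) ^ d / (n : ℝ) ^ d / ∏ i, w i)
  have hv : Tendsto v atTop (nhds (e / d.factorial * (1 - 1 / ∏ i, w i))) :=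
    ((tendsto_natCast_add_pow_div d _).sub
      ((tendsto_natCast_add_pow_div d σ).div_const _)).const_mul _
  have hv' := ((continuous_coe_real_ereal.tendsto _).comp hv).liminf_eq
  rw [← hv']
  refine liminf_le_liminf ?_
  filter_upwards [eventually_gt_atTop C] with n hn
  refine EReal.coe_le_coe_iff.2 ?_
  have h1 := (le_simplexCount (d := d) (Nat.sub_le n C)).resolve_right (by omega)
  rw [Nat.cast_sub hn.le] at h1
  have h2 := simplexCount_le (N := n) hw (Nat.cast_nonneg n)
  have h3 := simplexCount_sub_le_card hn.le w
  rw [Nat.cast_sub hn.le] at h3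
  have h4 := card_monomials_le_lengthQuotient hk hν hx hxν hxalg hm hC
    (Finset.univ.filter fun a : Fin d → Fin n =>
      ∑ i, (a i : ℕ) + C < n ∧ (n : ℝ) ≤ ∑ i, ((a i : ℕ) : ℝ) * w i)
    (fun a ha => (Finset.mem_filter.1 ha).2.1) (fun a ha => (Finset.mem_filter.1 ha).2.2)
  have h5 : (_ : ℝ) ≤ ((lengthQuotient hν n).toNat : ℝ) := Nat.cast_le.2 h4
  rw [Nat.cast_mul] at h5
  have h6 := mul_le_mul_of_nonneg_right
    (((sub_le_sub h1 h2).trans h3)) (Nat.cast_nonneg (α := ℝ) e)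
  have hn0 : (0 : ℝ) < n := Nat.cast_pos.2 (by omega)
  calc v n = (((n : ℝ) - C) ^ d / d.factorial -
        ((n : ℝ) + σ) ^ d / (d.factorial * ∏ i, w i)) * e / (n : ℝ) ^ d := by
        have hπ : ∏ i, w i ≠ 0 := (Finset.prod_pos fun i _ => hw i).ne'
        simp only [v, ← sub_eq_add_neg]
        field_simp
    _ ≤ _ := by gcongr; exact h6.trans h5
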